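/- Let $R$ be a finite, reduced, crystallographic root system spanning a vector space $V$ over a field $k$ of characteristic $0$ (for example the roots of a complex semisimple Lie algebra with respect to a Cartan subalgebra, with $k=\mathbb C$ or, taking for $V$ the real span of the roots, with $k=\mathbb R$), and let $R^+$ be the set of positive roots with respect to a base of $R$. Let $\Gamma(R^+)$ (the basis graph) be the graph whose vertices are all subsets of $R^+$, including $\emptyset$, in which $\{\sigma,\tau\}$ is an edge if and only if there are $e,e_1,e_2\in R^+$ with $e=e_1+e_2$ such that either $\sigma\setminus\tau=\{e\}$ and $\tau\setminus\sigma=\{e_1,e_2\}$, or $\tau\setminus\sigma=\{e\}$ and $\sigma\setminus\tau=\{e_1,e_2\}$. Let $\varrho=\frac12\sum_{e\in R^+}e$, define the weight of a vertex by $\omega(\sigma)=\varrho-\sum_{e\in\sigma}e\in V$, let $\Omega(R^+)$ be the image of $\omega$, and for $\alpha\in\Omega(R^+)$ let the weight subgraph $\Gamma(\alpha)$ be the full subgraph of $\Gamma(R^+)$ with vertex set $\omega^{-1}(\alpha)$. Then the weight decomposition $$\Gamma(R^+)=\bigsqcup_{\alpha\in\Omega(R^+)}\Gamma(\alpha)$$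 (a disjoint union of graphs: every vertex lies in exactly one $\Gamma(\alpha)$, and the endpoints of every edge lie in a common $\Gamma(\alpha)$) is the decomposition of $\Gamma(R^+)$ into its connected components. That is, every weight subgraph $\Gamma(\alpha)$ with $\alpha\in\Omega(R^+)$ is connected, and the vertex sets of the connected components of $\Gamma(R^+)$ are exactly the sets $\omega^{-1}(\alpha)$, $\alpha\in\Omega(R^+)$. -/

import Mathlib

/-!
In the definitions below, `P` is a root system with a base `b`, over a field `k` of characteristic
zero; it is finite, reduced and crystallographic wherever it matters. Taking `k = ℂ` and
`P = LieAlgebra.IsKilling.rootSystem H` gives the roots of a complex semisimple Lie algebra with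
respect to a Cartan subalgebra `H`; taking `k = ℝ` gives the same roots regarded as vectors of the
real vector space that they span.
-/

noncomputable section

namespace PositiveRootSystem

/-- The set `R⁺` of the roots that are positive with respect to the base `b`, given by their indices
(the map `P.root` from indices to roots is injective). -/
abbrev PosRoot {ι k V N : Type*} [Field k] [CharZero k]
    [AddCommGroup V] [Module k V] [AddCommGroup N] [Module k N]
    {P : RootPairing ι k V N} (b : P.Base) : Type _ :=
  {i : ι // b.IsPos i}

/-- A positive root, as a vector of `V`. -/
def rootVec {ι k V N : Type*} [Field k] [CharZero k]
    [AddCommGroup V] [Module k V] [AddCommGroup N] [Module k N]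
    {P : RootPairing ι k V N} (b : P.Base) (e : PosRoot b) : V :=
  P.root e.1

open scoped Classical in
/-- The condition on vertices `σ`, `τ` that `σ ∖ τ = {e}` and `τ ∖ σ = {e₁, e₂}` for some positive
roots with `e = e₁ + e₂`. -/
def Splits {ι k V N : Type*} [Field k] [CharZero k]
    [AddCommGroup V] [Module k V] [AddCommGroup N] [Module k N]
    {P : RootPairing ι k V N} (b : P.Base) (σ τ : Finset (PosRoot b)) : Prop :=
  ∃ e e₁ e₂ : PosRoot b, rootVec b e = rootVec b e₁ + rootVec b e₂ ∧
    σ \ τ = {e} ∧ τ \ σ = {e₁, e₂}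

/-- The basis graph `Γ(R⁺)`: the vertices are all subsets of `R⁺`, and `{σ, τ}` is an edge when one
of the two arises from the other by replacing a positive root `e = e₁ + e₂` by the pair of positive
roots `e₁, e₂`. -/
def basisGraph {ι k V N : Type*} [Field k] [CharZero k]
    [AddCommGroup V] [Module k V] [AddCommGroup N] [Module k N]
    {P : RootPairing ι k V N} (b : P.Base) : SimpleGraph (Finset (PosRoot b)) where
  Adj σ τ := Splits b σ τ ∨ Splits b τ σ
  symm := ⟨fun _ _ h => h.symm⟩
  loopless := ⟨fun σ h => by
    classical
    have h' : Splits b σ σ := h.elim id id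
    obtain ⟨e, _, _, _, h1, _⟩ := h'
    have he : e ∈ ({e} : Finset (PosRoot b)) := Finset.mem_singleton_self e
    rw [← h1, Finset.mem_sdiff] at he
    exact he.2 he.1⟩

/-- The half sum `ϱ` of the positive roots (the sum is over the finite type `PosRoot b`). -/
def halfSum {ι k V N : Type*} [Finite ι] [Field k] [CharZero k]
    [AddCommGroup V] [Module k V] [AddCommGroup N] [Module k N]
    {P : RootPairing ι k V N} (b : P.Base) : V :=
  (2⁻¹ : k) • ∑ᶠ e : PosRoot b, rootVec b e

/-- The weight `ω(σ) = ϱ - ∑_{e ∈ σ} e` of a vertex of the basis graph. -/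
def weight {ι k V N : Type*} [Finite ι] [Field k] [CharZero k]
    [AddCommGroup V] [Module k V] [AddCommGroup N] [Module k N]
    {P : RootPairing ι k V N} (b : P.Base) (σ : Finset (PosRoot b)) : V :=
  halfSum b - ∑ e ∈ σ, rootVec b e

/-- The weight set `Ω(R⁺)`, the image of `ω`. -/
def weightSet {ι k V N : Type*} [Finite ι] [Field k] [CharZero k]
    [AddCommGroup V] [Module k V] [AddCommGroup N] [Module k N]
    {P : RootPairing ι k V N} (b : P.Base) : Set V :=
  Set.range (weight b)

/-- The vertex set `ω⁻¹(α)` of the weight subgraph `Γ(α)`. -/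
def weightVertices {ι k V N : Type*} [Finite ι] [Field k] [CharZero k]
    [AddCommGroup V] [Module k V] [AddCommGroup N] [Module k N]
    {P : RootPairing ι k V N} (b : P.Base) (α : V) : Set (Finset (PosRoot b)) :=
  {σ | weight b σ = α}

/-- The weight subgraph `Γ(α)`: the full subgraph of the basis graph on the vertices of weight `α`. -/
def weightSubgraph {ι k V N : Type*} [Finite ι] [Field k] [CharZero k]
    [AddCommGroup V] [Module k V] [AddCommGroup N] [Module k N]
    {P : RootPairing ι k V N} (b : P.Base) (α : V) : SimpleGraph (weightVertices b α) :=
  (basisGraph b).induce (weightVertices b α)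

end PositiveRootSystem

end

open scoped symmDiff

/-! ### Vanishing sums of roots -/

namespace RootPairing

variable {ι k V N : Type*} [Finite ι] [Field k] [CharZero k]
  [AddCommGroup V] [Module k V] [AddCommGroup N] [Module k N]
  (P : RootPairing ι k V N) [P.IsCrystallographic]

/-! Edges preserve weight, so the point is to join `σ` and `τ` of equal weight. Orient each positive
root as `-e` if `e ∈ σ` and as `e` otherwise; the oriented roots over `σ ∆ τ` then sum to zero
(`sum_orient_symmDiff`). No nonempty sum of roots from an addition-closed set without opposite roots
vanishes (`eq_zero_of_sum_root_eq_zero_of_closed`), so two of these oriented roots add up to a root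
outside their set. This gives three oriented roots with zero sum, for `σ` or for `τ`, and reversing
them is an edge (`adj_symmDiff_of_orient_add_add_eq_zero`). Two of the three lie in `σ ∆ τ`, so the
difference shrinks, and induction on its size finishes. -/

/-- If the roots indexed by a multiset sum to `-P.root i`, one of them makes an obtuse angle with
`P.root i`. -/
lemma exists_pairingIn_neg_of_root_add_sum_eq_zero {i : ι} {m : Multiset ι}
    (h : P.root i + (m.map P.root).sum = 0) : ∃ j ∈ m, P.pairingIn ℤ i j < 0 := by
  by_contra! hm
  have hm' : ∀ j ∈ m, 0 ≤ P.pairingIn ℤ j i := fun j hj => by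
    have := hm j hj
    by_contra! hlt
    exact absurd ((P.pairingIn_lt_zero_iff ℤ).mp hlt) this.not_gt
  -- Evaluate the coroot of `i` on the relation; the 2 is the pairing of `i` with itself.
  have hk : ((2 + (m.map fun j => P.pairingIn ℤ j i).sum : ℤ) : k) = 0 := by
    have h' := congrArg (P.coroot' i) h
    have hs : P.coroot' i (m.map P.root).sum = (m.map fun j => P.pairing j i).sum := by
      rw [map_multiset_sum, Multiset.map_map]
      rfl
    rw [map_add, map_zero, hs, root_coroot'_eq_pairing, pairing_same] at h'
    have hp : (m.map fun j => P.pairing j i) =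
        (m.map fun j => P.pairingIn ℤ j i).map (Int.castRingHom k) := by
      rw [Multiset.map_map]
      exact Multiset.map_congr rfl fun j _ => (P.algebraMap_pairingIn ℤ j i).symm
    rw [hp, ← map_multiset_sum] at h'
    simpa using h'
  have h0 : 0 ≤ (m.map fun j => P.pairingIn ℤ j i).sum :=
    Multiset.sum_nonneg (by simpa using hm')
  have := Int.cast_eq_zero.mp hk
  lia

/-- A set of roots that is closed under addition of roots and contains no pair of opposite roots
admits no nonempty multiset with vanishing sum. -/
lemma eq_zero_of_sum_root_eq_zero_of_closed {S : Set ι}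
    (hneg : ∀ i ∈ S, ∀ j ∈ S, P.root i ≠ -P.root j)
    (hadd : ∀ i ∈ S, ∀ j ∈ S, ∀ l, P.root l = P.root i + P.root j → l ∈ S)
    (m : Multiset ι) (hm : ∀ i ∈ m, i ∈ S) (h0 : (m.map P.root).sum = 0) : m = 0 := by
  induction hn : m.card generalizing m with
  | zero => exact Multiset.card_eq_zero.mp hn
  | succ n ih =>
    exfalso
    obtain ⟨i, hi⟩ := Multiset.card_pos_iff_exists_mem.mp (n.succ_pos.trans_eq hn.symm)
    obtain ⟨m, rfl⟩ := Multiset.exists_cons_of_mem hi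
    rw [Multiset.map_cons, Multiset.sum_cons] at h0
    obtain ⟨j, hj, hij⟩ := P.exists_pairingIn_neg_of_root_add_sum_eq_zero h0
    obtain ⟨m, rfl⟩ := Multiset.exists_cons_of_mem hj
    have hi : i ∈ S := hm i (by simp)
    have hj : j ∈ S := hm j (by simp)
    -- Merging `i` and `j` into the root `l` keeps the sum and stays in `S`, with one term fewer but
    -- still at least one. The merged root may repeat a term, hence multisets.
    obtain ⟨l, hl⟩ := P.root_add_root_mem_of_pairingIn_neg hij (hneg i hi j hj)
    have := ih (l ::ₘ m) (fun x hx => ?_) ?_ (by simpa using hn)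
    · simp at this
    · rcases Multiset.mem_cons.mp hx with rfl | hx
      · exact hadd i hi j hj _ hl
      · exact hm x (by simp [hx])
    · rw [Multiset.map_cons, Multiset.sum_cons] at h0 ⊢
      rw [hl, add_assoc, h0]

end RootPairing

lemma Finset.card_symmDiff_triple_lt {α : Type*} [DecidableEq α] {D : Finset α} {x y z : α}
    (hx : x ∈ D) (hy : y ∈ D) (hxy : x ≠ y) : (D ∆ {x, y, z}).card < D.card := by
  have hsub : D ∆ {x, y, z} ⊆ insert z ((D.erase x).erase y) := by
    intro w hw
    simp only [Finset.mem_symmDiff, Finset.mem_insert, Finset.mem_singleton,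
      Finset.mem_erase] at hw ⊢
    grind
  have h1 := (Finset.card_le_card hsub).trans (Finset.card_insert_le _ _)
  have h2 := Finset.card_erase_add_one (Finset.mem_erase.mpr ⟨hxy.symm, hy⟩)
  have h3 := Finset.card_erase_add_one hx
  lia

/-! ### Oriented roots and edges -/

namespace PositiveRootSystem

open scoped Classical in
/-- The element of `{e, -e}` that enters `2 • weight b σ`. -/
noncomputable def orient {ι k V N : Type*} [Field k] [CharZero k]
    [AddCommGroup V] [Module k V] [AddCommGroup N] [Module k N]
    {P : RootPairing ι k V N} (b : P.Base) (σ : Finset (PosRoot b)) (e : PosRoot b) : V :=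
  if e ∈ σ then -rootVec b e else rootVec b e

section

variable {ι k V N : Type*} [Field k] [CharZero k]
  [AddCommGroup V] [Module k V] [AddCommGroup N] [Module k N]
  {P : RootPairing ι k V N} (b : P.Base) {σ τ : Finset (PosRoot b)} {e e₁ e₂ : PosRoot b}

lemma orient_of_mem (h : e ∈ σ) : orient b σ e = -rootVec b e := if_pos h

lemma orient_of_notMem (h : e ∉ σ) : orient b σ e = rootVec b e := if_neg h

lemma orient_eq_or (σ : Finset (PosRoot b)) (e : PosRoot b) :
    orient b σ e = rootVec b e ∨ orient b σ e = -rootVec b e := by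
  by_cases h : e ∈ σ
  · exact .inr (orient_of_mem b h)
  · exact .inl (orient_of_notMem b h)

open scoped Classical in
lemma orient_eq_neg_of_mem_symmDiff (h : e ∈ σ ∆ τ) : orient b τ e = -orient b σ e := by
  rcases Finset.mem_symmDiff.mp h with ⟨h1, h2⟩ | ⟨h1, h2⟩ <;>
    simp [orient, h1, h2]

open scoped Classical in
lemma orient_eq_of_notMem_symmDiff (h : e ∉ σ ∆ τ) : orient b τ e = orient b σ e := by
  have : e ∈ σ ↔ e ∈ τ := by
    rw [Finset.mem_symmDiff] at h
    tauto
  simp [orient, this]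

open scoped Classical in
lemma sum_orient_symmDiff (h : ∑ e ∈ σ, rootVec b e = ∑ e ∈ τ, rootVec b e) :
    ∑ e ∈ σ ∆ τ, orient b σ e = 0 := by
  have h1 : ∑ e ∈ σ \ τ, orient b σ e = -∑ e ∈ σ \ τ, rootVec b e := by
    rw [← Finset.sum_neg_distrib]
    exact Finset.sum_congr rfl fun e he => orient_of_mem b (Finset.mem_sdiff.mp he).1
  have h2 : ∑ e ∈ τ \ σ, orient b σ e = ∑ e ∈ τ \ σ, rootVec b e :=
    Finset.sum_congr rfl fun e he => orient_of_notMem b (Finset.mem_sdiff.mp he).2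
  rw [symmDiff_def, Finset.sup_eq_union, Finset.sum_union disjoint_sdiff_sdiff, h1, h2,
    neg_add_eq_zero, ← add_right_inj (∑ e ∈ σ ∩ τ, rootVec b e), Finset.sum_inter_add_sum_sdiff,
    Finset.inter_comm, Finset.sum_inter_add_sum_sdiff, h]

lemma rootVec_ne_neg [Finite ι] [P.IsCrystallographic] [P.IsReduced] (e₁ e₂ : PosRoot b) :
    rootVec b e₁ ≠ -rootVec b e₂ := by
  intro h
  let := P.indexNeg
  have h' : e₁.1 = -e₂.1 := P.root.injective (by simpa [rootVec] using h)
  exact (RootPairing.Base.IsPos.neg_iff_not b e₂.1).mp (h' ▸ e₁.2) e₂.2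

lemma rootVec_add_add_ne_zero [Finite ι] [P.IsCrystallographic] [P.IsReduced]
    (e e₁ e₂ : PosRoot b) : rootVec b e + rootVec b e₁ + rootVec b e₂ ≠ 0 := by
  intro h
  let := P.indexNeg
  have h' : P.root (-e₂.1) = P.root e.1 + P.root e₁.1 := by
    rw [RootPairing.indexNeg_neg, RootPairing.root_reflectionPerm,
      RootPairing.reflection_apply_self]
    exact (eq_neg_of_add_eq_zero_left h).symm
  exact (RootPairing.Base.IsPos.neg_iff_not b e₂.1).mp (e.2.add e₁.2 h') e₂.2

lemma rootVec_ne_add_self [Finite ι] [P.IsReduced] (e e₁ : PosRoot b) :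
    rootVec b e ≠ rootVec b e₁ + rootVec b e₁ := by
  intro h
  have : IsAddTorsionFree V := .of_isTorsionFree k V
  exact P.nsmul_notMem_range_root (n := 2) (i := e₁.1) ⟨e.1, by rw [two_nsmul]; exact h⟩

/-- Otherwise twice a root would be a root up to sign. Distinctness is what makes the descent
strict. -/
lemma ne_of_orient_add_add_eq_zero [Finite ι] [P.IsReduced] (σ : Finset (PosRoot b))
    (h : orient b σ e + orient b σ e₁ + orient b σ e₂ = 0) : e ≠ e₁ := by
  rintro rfl
  have h3 : rootVec b e₂ = rootVec b e + rootVec b e ∨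
      -rootVec b e₂ = rootVec b e + rootVec b e := by
    rw [add_eq_zero_iff_eq_neg] at h
    rcases orient_eq_or b σ e with h1 | h1 <;> rcases orient_eq_or b σ e₂ with h2 | h2 <;>
      rw [h1, h2] at h
    · exact .inr h.symm
    · exact .inl (by rw [h, neg_neg])
    · exact .inl (by rw [← neg_inj, ← h, neg_add])
    · refine .inr ?_
      rw [← neg_inj, ← h, neg_add]
  rcases h3 with h3 | h3
  · exact rootVec_ne_add_self b _ _ h3
  · let := P.indexNeg
    have : IsAddTorsionFree V := .of_isTorsionFree k V
    exact P.nsmul_notMem_range_root (n := 2) (i := e.1)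
      ⟨-e₂.1, by rw [two_nsmul]; simpa [rootVec] using h3⟩

lemma orient_ne_neg [Finite ι] [P.IsCrystallographic] [P.IsReduced] (σ : Finset (PosRoot b))
    (e₁ e₂ : PosRoot b) : orient b σ e₁ ≠ -orient b σ e₂ := by
  have hself : ∀ v : V, v = -v → v = 0 := fun v hv => by
    have : IsAddTorsionFree V := .of_isTorsionFree k V
    exact self_eq_neg.mp hv
  by_cases h1 : e₁ ∈ σ <;> by_cases h2 : e₂ ∈ σ <;> intro h <;>
    simp only [orient, h1, h2, if_true, if_false, neg_neg] at h
  · exact rootVec_ne_neg b e₂ e₁ (by rw [h])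
  · rw [neg_inj] at h
    have : e₁ = e₂ := Subtype.ext (P.root.injective h)
    exact h2 (this ▸ h1)
  · have : e₁ = e₂ := Subtype.ext (P.root.injective h)
    exact h1 (this ▸ h2)
  · exact rootVec_ne_neg b _ _ h

open scoped Classical in
lemma splits_symmDiff_of_mem (he : e ∈ σ) (he₁ : e₁ ∉ σ) (he₂ : e₂ ∉ σ)
    (h : rootVec b e = rootVec b e₁ + rootVec b e₂) : Splits b σ (σ ∆ {e, e₁, e₂}) := by
  refine ⟨e, e₁, e₂, h, ?_, ?_⟩ <;> ext x <;>
    simp only [Finset.mem_sdiff, Finset.mem_symmDiff, Finset.mem_insert, Finset.mem_singleton] <;>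
    grind

open scoped Classical in
lemma splits_symmDiff_of_notMem (he : e ∉ σ) (he₁ : e₁ ∈ σ) (he₂ : e₂ ∈ σ)
    (h : rootVec b e = rootVec b e₁ + rootVec b e₂) : Splits b (σ ∆ {e, e₁, e₂}) σ := by
  refine ⟨e, e₁, e₂, h, ?_, ?_⟩ <;> ext x <;>
    simp only [Finset.mem_sdiff, Finset.mem_symmDiff, Finset.mem_insert, Finset.mem_singleton] <;>
    grind

open scoped Classical in
/-- Reversing three oriented roots with vanishing sum is a move along an edge. -/
lemma adj_symmDiff_of_orient_add_add_eq_zero [Finite ι] [P.IsCrystallographic] [P.IsReduced]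
    (h : orient b σ e + orient b σ e₁ + orient b σ e₂ = 0) :
    (basisGraph b).Adj σ (σ ∆ {e, e₁, e₂}) := by
  have hp1 : ({e, e₁, e₂} : Finset (PosRoot b)) = {e₁, e, e₂} := Finset.insert_comm _ _ _
  have hp2 : ({e, e₁, e₂} : Finset (PosRoot b)) = {e₂, e, e₁} := by
    ext; simp only [Finset.mem_insert, Finset.mem_singleton]; tauto
  -- Equal signs contradict positivity; otherwise the root with the minority sign is the sum of the
  -- other two.
  by_cases h0 : e ∈ σ <;> by_cases h1 : e₁ ∈ σ <;> by_cases h2 : e₂ ∈ σ <;>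
    simp only [orient, h0, h1, h2, if_true, if_false] at h
  · exact absurd (by rw [← neg_eq_zero, ← h]; abel) (rootVec_add_add_ne_zero b e e₁ e₂)
  · rw [hp2]
    exact .inr (splits_symmDiff_of_notMem b h2 h0 h1 (by rw [← sub_eq_zero, ← h]; abel))
  · rw [hp1]
    exact .inr (splits_symmDiff_of_notMem b h1 h0 h2 (by rw [← sub_eq_zero, ← h]; abel))
  · exact .inl (splits_symmDiff_of_mem b h0 h1 h2 (by
      rw [← sub_eq_zero, ← neg_eq_zero, ← h]; abel))
  · exact .inr (splits_symmDiff_of_notMem b h0 h1 h2 (by rw [← sub_eq_zero, ← h]; abel))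
  · rw [hp1]
    exact .inl (splits_symmDiff_of_mem b h1 h0 h2 (by
      rw [← sub_eq_zero, ← neg_eq_zero, ← h]; abel))
  · rw [hp2]
    exact .inl (splits_symmDiff_of_mem b h2 h0 h1 (by
      rw [← sub_eq_zero, ← neg_eq_zero, ← h]; abel))
  · exact absurd h (rootVec_add_add_ne_zero b e e₁ e₂)

lemma Splits.sum_eq [Finite ι] [P.IsReduced] (h : Splits b σ τ) :
    ∑ e ∈ σ, rootVec b e = ∑ e ∈ τ, rootVec b e := by
  classical
  obtain ⟨e, e₁, e₂, he, h1, h2⟩ := h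
  have hne : e₁ ≠ e₂ := by
    rintro rfl
    exact rootVec_ne_add_self b _ _ he
  have h1' : σ \ τ = {e} := by convert h1
  have h2' : τ \ σ = {e₁, e₂} := by convert h2
  rw [← Finset.sum_inter_add_sum_sdiff σ τ, ← Finset.sum_inter_add_sum_sdiff τ σ, h1', h2',
    Finset.sum_singleton, Finset.sum_pair hne, he, Finset.inter_comm]

lemma weight_eq_iff [Finite ι] : weight b σ = weight b τ ↔
    ∑ e ∈ σ, rootVec b e = ∑ e ∈ τ, rootVec b e := sub_right_inj

lemma weight_eq_of_adj [Finite ι] [P.IsReduced] (h : (basisGraph b).Adj σ τ) :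
    weight b σ = weight b τ :=
  (weight_eq_iff b).mpr (h.elim (Splits.sum_eq b) fun h => (Splits.sum_eq b h).symm)

lemma weight_eq_of_reachable [Finite ι] [P.IsReduced] (h : (basisGraph b).Reachable σ τ) :
    weight b σ = weight b τ := by
  obtain ⟨p⟩ := h
  induction p with
  | nil => rfl
  | cons h _ ih => exact (weight_eq_of_adj b h).trans ih

/-! ### Descent on the symmetric difference -/

open scoped Classical in
/-- Two distinct vertices of the same weight differ at two roots that can be reversed along an edge
starting at one of these vertices. -/
lemma exists_adj_symmDiff [Finite ι] [P.IsCrystallographic] [P.IsReduced] (hne : σ ≠ τ)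
    (h : weight b σ = weight b τ) :
    ∃ e₁ ∈ σ ∆ τ, ∃ e₂ ∈ σ ∆ τ, ∃ e, e₁ ≠ e₂ ∧
      ((basisGraph b).Adj σ (σ ∆ {e₁, e₂, e}) ∨ (basisGraph b).Adj τ (τ ∆ {e₁, e₂, e})) := by
  let := P.indexNeg
  let f : PosRoot b → ι := fun e => if e ∈ σ then -e.1 else e.1
  have hf : ∀ e, P.root (f e) = orient b σ e := fun e => by
    by_cases he : e ∈ σ <;> simp [f, orient, he, rootVec]
  by_contra! hcon
  have hneg : ∀ i ∈ f '' ↑(σ ∆ τ), ∀ j ∈ f '' ↑(σ ∆ τ), P.root i ≠ -P.root j := by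
    rintro _ ⟨e₁, -, rfl⟩ _ ⟨e₂, -, rfl⟩
    rw [hf, hf]
    exact orient_ne_neg b σ e₁ e₂
  have hadd : ∀ i ∈ f '' ↑(σ ∆ τ), ∀ j ∈ f '' ↑(σ ∆ τ), ∀ l,
      P.root l = P.root i + P.root j → l ∈ f '' ↑(σ ∆ τ) := by
    rintro _ ⟨e₁, he₁, rfl⟩ _ ⟨e₂, he₂, rfl⟩ l hl
    rw [Finset.mem_coe] at he₁ he₂
    obtain ⟨e, he⟩ : ∃ e : PosRoot b, P.root l = orient b σ e ∨ P.root l = -orient b σ e := by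
      rcases RootPairing.Base.IsPos.or_neg b l with hp | hp
      · refine ⟨⟨l, hp⟩, ?_⟩
        rcases orient_eq_or b σ ⟨l, hp⟩ with h | h <;> simp [h, rootVec]
      · refine ⟨⟨-l, hp⟩, ?_⟩
        have hl' : P.root l = -rootVec b ⟨-l, hp⟩ := by simp [rootVec]
        rcases orient_eq_or b σ ⟨-l, hp⟩ with h | h <;> rw [h, hl'] <;> simp
    rw [hf, hf] at hl
    rcases he with he | he
    -- Passing from `σ` to `τ` flips `e₁` and `e₂` but not `e`, so the relation becomes a zero sum
    -- for `τ`.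
    · by_contra hmem
      have hemem : e ∉ σ ∆ τ := fun h' =>
        hmem ⟨e, Finset.mem_coe.mpr h', P.root.injective (by rw [hf, he])⟩
      have h0 : orient b τ e₁ + orient b τ e₂ + orient b τ e = 0 := by
        rw [orient_eq_neg_of_mem_symmDiff b he₁, orient_eq_neg_of_mem_symmDiff b he₂,
          orient_eq_of_notMem_symmDiff b hemem, ← he, hl]
        abel
      exact (hcon e₁ he₁ e₂ he₂ e (ne_of_orient_add_add_eq_zero b τ h0)).2
        (adj_symmDiff_of_orient_add_add_eq_zero b h0)
    -- Here the sum is already zero for `σ`, whether or not `e` lies in `σ ∆ τ`.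
    · have h0 : orient b σ e₁ + orient b σ e₂ + orient b σ e = 0 := by
        rw [← hl, he, neg_add_cancel]
      exact absurd (adj_symmDiff_of_orient_add_add_eq_zero b h0)
        (hcon e₁ he₁ e₂ he₂ e (ne_of_orient_add_add_eq_zero b σ h0)).1
  have hzero := P.eq_zero_of_sum_root_eq_zero_of_closed hneg hadd ((σ ∆ τ).val.map f)
    (fun i hi => by
      obtain ⟨e, he, rfl⟩ := Multiset.mem_map.mp hi
      exact ⟨e, he, rfl⟩)
    (by
      rw [Multiset.map_map]
      simp only [Function.comp_def, hf]
      exact sum_orient_symmDiff b ((weight_eq_iff b).mp h))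
  rw [Multiset.map_eq_zero, Finset.val_eq_zero, ← Finset.bot_eq_empty, symmDiff_eq_bot] at hzero
  exact hne hzero

lemma reachable_of_weight_eq [Finite ι] [P.IsCrystallographic] [P.IsReduced]
    (h : weight b σ = weight b τ) : (basisGraph b).Reachable σ τ := by
  classical
  induction hn : (σ ∆ τ).card using Nat.strong_induction_on generalizing σ τ with
  | _ n ih =>
    by_cases hne : σ = τ
    · exact hne ▸ .refl _
    subst hn
    obtain ⟨e₁, he₁, e₂, he₂, e, hee, hadj | hadj⟩ := exists_adj_symmDiff b hne h
    · refine hadj.reachable.trans (ih _ ?_ ((weight_eq_of_adj b hadj).symm.trans h) rfl)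
      rw [symmDiff_right_comm]
      exact Finset.card_symmDiff_triple_lt he₁ he₂ hee
    · refine .trans (ih _ ?_ (h.trans (weight_eq_of_adj b hadj)) rfl) hadj.reachable.symm
      rw [← symmDiff_assoc]
      exact Finset.card_symmDiff_triple_lt he₁ he₂ hee

lemma reachable_iff_weight_eq [Finite ι] [P.IsCrystallographic] [P.IsReduced] :
    (basisGraph b).Reachable σ τ ↔ weight b σ = weight b τ :=
  ⟨weight_eq_of_reachable b, reachable_of_weight_eq b⟩

lemma supp_connectedComponentMk [Finite ι] [P.IsCrystallographic] [P.IsReduced]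
    (σ : Finset (PosRoot b)) :
    ((basisGraph b).connectedComponentMk σ).supp = weightVertices b (weight b σ) := by
  ext τ
  rw [SimpleGraph.ConnectedComponent.mem_supp_iff, SimpleGraph.ConnectedComponent.eq,
    reachable_iff_weight_eq]
  rfl

end

end PositiveRootSystem

/-- The basis graph is the disjoint union of its weight subgraphs `Γ(α)`, `α ∈ Ω(R⁺)` (each vertex
lies in exactly one of them, and every edge lies inside one of them), every weight subgraph is
connected, and the vertex sets of the connected components of the basis graph are exactly the vertex
sets of the weight subgraphs. -/
theorem theorem5p3 {ι k V N : Type*} [Finite ι] [Field k] [CharZero k]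
    [AddCommGroup V] [Module k V] [AddCommGroup N] [Module k N]
    (P : RootPairing ι k V N) [P.IsRootSystem] [P.IsCrystallographic] [P.IsReduced]
    (b : P.Base) :
    (∀ σ : Finset (PositiveRootSystem.PosRoot b),
      ∃! α : V, α ∈ PositiveRootSystem.weightSet b ∧
        σ ∈ PositiveRootSystem.weightVertices b α) ∧
    (∀ σ τ : Finset (PositiveRootSystem.PosRoot b),
      (PositiveRootSystem.basisGraph b).Adj σ τ →
        ∃ α ∈ PositiveRootSystem.weightSet b,
          σ ∈ PositiveRootSystem.weightVertices b α ∧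
          τ ∈ PositiveRootSystem.weightVertices b α) ∧
    (∀ α ∈ PositiveRootSystem.weightSet b, (PositiveRootSystem.weightSubgraph b α).Connected) ∧
    Set.range (fun C : (PositiveRootSystem.basisGraph b).ConnectedComponent => C.supp) =
      PositiveRootSystem.weightVertices b '' PositiveRootSystem.weightSet b := by
  open PositiveRootSystem in
  refine ⟨fun σ => ⟨weight b σ, ⟨⟨σ, rfl⟩, rfl⟩, fun α hα => hα.2.symm⟩,
    fun σ τ h => ⟨weight b σ, ⟨σ, rfl⟩, rfl, (weight_eq_of_adj b h).symm⟩, ?_, ?_⟩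
  · rintro _ ⟨σ, rfl⟩
    rw [weightSubgraph, ← supp_connectedComponentMk]
    exact ((basisGraph b).connectedComponentMk σ).maximal_connected_induce_supp.prop
  · ext S
    constructor
    · rintro ⟨C, rfl⟩
      induction C using SimpleGraph.ConnectedComponent.ind with
      | _ σ => exact ⟨weight b σ, ⟨σ, rfl⟩, (supp_connectedComponentMk b σ).symm⟩
    · rintro ⟨_, ⟨σ, rfl⟩, rfl⟩
      exact ⟨(basisGraph b).connectedComponentMk σ, supp_connectedComponentMk b σ⟩
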